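/- Let $n,p\ge 0$ be integers and let $a,c$ be real numbers with $c>0$. View $S^{2n+1}\times S^{2p+1}\subset\mathbb C^{n+1}\times\mathbb C^{p+1}$ as the homogeneous space $U(n+1)/U(n)\times U(p+1)/U(p)$ with base point $o=(e_0,e_0)$, and let $\mathfrak u(n+1)\times\mathfrak u(p+1)=(\mathfrak u(n)\times\mathfrak u(p))\oplus\mathfrak p$, where $\mathfrak p\cong T_o(S^{2n+1}\times S^{2p+1})$ (via $A\mapsto A\cdot o$) has the basis $X^1,Y^1_1,\dots,Y^1_{2n},X^2,Y^2_1,\dots,Y^2_{2p}$. Here the upper index denotes the factor and, with $E_{\nu\mu}$ the matrix units (rows and columns numbered from $0$), $X=iE_{00}$, $Y_{2\nu-1}=E_{\nu0}-E_{0\nu}$, $Y_{2\nu}=i(E_{\nu0}+E_{0\nu})$. Let $\omega$ be the invariant 2-form and $I(a,c)$ the invariant almost complex structure on $S^{2n+1}\times S^{2p+1}$ given on this basis by $$\omega=X^1\wedge X^2+\sum_{\nu=1}^nY^1_{2\nu-1}\wedge Y^1_{2\nu}+\sum_{\nu=1}^pY^2_{2\nu-1}\wedge Y^2_{2\nu}$$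 (the dual forms being denoted like the basis vectors) and $$I(a,c)X^1=\tfrac acX^1+\tfrac1cX^2,\quad I(a,c)X^2=-\tfrac{a^2+c^2}{c}X^1-\tfrac acX^2,\quad I(a,c)Y^j_{2\nu-1}=Y^j_{2\nu},\quad I(a,c)Y^j_{2\nu}=-Y^j_{2\nu-1},$$ and let $g(X,Y)=\omega(X,I(a,c)Y)$, an invariant Riemannian metric. Let $\nabla$ be its Levi-Civita connection, and let $R(X,Y)Z=\nabla_X\nabla_YZ-\nabla_Y\nabla_XZ-\nabla_{[X,Y]}Z$ be its curvature. Let $$Z_0=\sqrt c\,X^1,\quad Z_\nu=Y^1_\nu\ (1\le\nu\le 2n),\quad Z_{2n+1}=\tfrac{a}{\sqrt c}X^1+\tfrac1{\sqrt c}X^2,\quad Z_{2n+1+\mu}=Y^2_\mu\ (1\le\mu\le 2p),$$ which is a $g$-orthonormal basis of $\mathfrak p$, and put $R_{(\alpha\nu)(\rho\mu)}=g(R(Z_\alpha,Z_\nu)Z_\mu,Z_\rho)$ at $o$. Then $$R_{(2l-1,\,2l)(2n+2m,\,2n+2m+1)}=\frac{2a}{c}\qquad(1\le l\le n,\ 1\le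 m\le p),$$ and $R_{(\alpha\nu)(\rho\mu)}=0$ for all other indices with $1\le\alpha<\nu\le 2n$ and $2n+2\le\rho<\mu\le 2n+2p+1$. -/

import Mathlib

open scoped ContDiff

noncomputable section

namespace SphereProduct

/-! ### The manifold `S^(2n+1) × S^(2p+1)` as a submanifold of `ℂ^(n+1) × ℂ^(p+1)` -/

/-- The ambient space `ℂ^(n+1) × ℂ^(p+1)`; only its real smooth structure and the Hermitian inner
products of the two factors are used. -/
abbrev Ambient (n p : ℕ) : Type :=
  EuclideanSpace ℂ (Fin (n + 1)) × EuclideanSpace ℂ (Fin (p + 1))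

variable {n p : ℕ}

/-- The product `S^(2n+1) × S^(2p+1)` of the unit spheres. -/
def manifold (n p : ℕ) : Set (Ambient n p) :=
  Metric.sphere (0 : EuclideanSpace ℂ (Fin (n + 1))) 1 ×ˢ
    Metric.sphere (0 : EuclideanSpace ℂ (Fin (p + 1))) 1

/-- The (real) tangent space of `S^(2n+1) × S^(2p+1)` at a point `x` of it: the vectors whose
components are orthogonal, for the real inner product, to the components of `x`. -/
def tangent (x : Ambient n p) : Set (Ambient n p) :=
  {u | (inner ℂ x.1 u.1).re = 0 ∧ (inner ℂ x.2 u.2).re = 0}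

/-- Smooth vector fields on `S^(2n+1) × S^(2p+1)`, each given by a smooth extension to the ambient
space. Only the values on `S^(2n+1) × S^(2p+1)` matter. -/
def IsVectorField (X : Ambient n p → Ambient n p) : Prop :=
  ContDiff ℝ ∞ X ∧ ∀ x ∈ manifold n p, X x ∈ tangent x

/-! ### The invariant tensors `ω`, `I(a,c)` and `g(a,c)` -/

/-- Coefficient of the first fibre direction `(i z, 0)` in a tangent vector at `x = (z, w)`. -/
def fib₁ (x u : Ambient n p) : ℝ := (inner ℂ x.1 u.1).im

/-- Coefficient of the second fibre direction `(0, i w)` in a tangent vector at `x = (z, w)`. -/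
def fib₂ (x u : Ambient n p) : ℝ := (inner ℂ x.2 u.2).im

/-- First component of the horizontal part of `u` at `x`. -/
def hor₁ (x u : Ambient n p) : EuclideanSpace ℂ (Fin (n + 1)) :=
  u.1 - (inner ℂ x.1 u.1 : ℂ) • x.1

/-- Second component of the horizontal part of `u` at `x`. -/
def hor₂ (x u : Ambient n p) : EuclideanSpace ℂ (Fin (p + 1)) :=
  u.2 - (inner ℂ x.2 u.2 : ℂ) • x.2

/-- The invariant 2-form
`ω = X¹ ∧ X² + ∑ Y¹_(2ν-1) ∧ Y¹_(2ν) + ∑ Y²_(2ν-1) ∧ Y²_(2ν)`: the product of the two fibre forms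
plus the standard Kähler form on horizontal vectors. -/
def form (x u v : Ambient n p) : ℝ :=
  (fib₁ x u * fib₂ x v - fib₂ x u * fib₁ x v) +
    (inner ℂ (hor₁ x u) (hor₁ x v)).im + (inner ℂ (hor₂ x u) (hor₂ x v)).im

/-- The invariant complex structure `I(a,c)`: multiplication by `i` on horizontal vectors, and
`X¹ ↦ (a/c) X¹ + (1/c) X²`, `X² ↦ -((a²+c²)/c) X¹ - (a/c) X²` on the fibre directions. -/
def cplx (a c : ℝ) (x u : Ambient n p) : Ambient n p :=
  (Complex.I • hor₁ x u +
      ((a / c * fib₁ x u - (a ^ 2 + c ^ 2) / c * fib₂ x u : ℝ) : ℂ) • (Complex.I • x.1),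
   Complex.I • hor₂ x u +
      ((1 / c * fib₁ x u - a / c * fib₂ x u : ℝ) : ℂ) • (Complex.I • x.2))

/-- The metric `g(a,c)(X, Y) = ω(X, I(a,c) Y)` associated with `ω` and `I(a,c)`. -/
def metric (a c : ℝ) (x u v : Ambient n p) : ℝ := form x u (cplx a c x v)

/-- `ω` is invariant under `U(n+1) × U(p+1)`. -/
theorem form_map (U : EuclideanSpace ℂ (Fin (n + 1)) ≃ₗᵢ[ℂ] EuclideanSpace ℂ (Fin (n + 1)))
    (V : EuclideanSpace ℂ (Fin (p + 1)) ≃ₗᵢ[ℂ] EuclideanSpace ℂ (Fin (p + 1)))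
    (x u v : Ambient n p) :
    form (U x.1, V x.2) (U u.1, V u.2) (U v.1, V v.2) = form x u v := by
  simp only [form, fib₁, fib₂, hor₁, hor₂, LinearIsometryEquiv.inner_map_map, ← map_smul,
    ← map_sub]

/-- `I(a,c)` is invariant under `U(n+1) × U(p+1)`. -/
theorem cplx_map (a c : ℝ)
    (U : EuclideanSpace ℂ (Fin (n + 1)) ≃ₗᵢ[ℂ] EuclideanSpace ℂ (Fin (n + 1)))
    (V : EuclideanSpace ℂ (Fin (p + 1)) ≃ₗᵢ[ℂ] EuclideanSpace ℂ (Fin (p + 1)))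
    (x u : Ambient n p) :
    cplx a c (U x.1, V x.2) (U u.1, V u.2) =
      (U (cplx a c x u).1, V (cplx a c x u).2) := by
  simp only [cplx, fib₁, fib₂, hor₁, hor₂, LinearIsometryEquiv.inner_map_map, ← map_smul,
    ← map_sub, ← map_add]

/-! ### Levi-Civita connection and curvature -/

/-- `D X Y` (for `D_X Y`) is the Levi-Civita connection of `g(a,c)` on `S^(2n+1) × S^(2p+1)`:
a connection on the smooth vector fields that is metric and torsion-free. -/
structure IsLeviCivita (a c : ℝ)
    (D : (Ambient n p → Ambient n p) → (Ambient n p → Ambient n p) → Ambient n p → Ambient n p) :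
    Prop where
  isVectorField : ∀ X Y, IsVectorField X → IsVectorField Y → IsVectorField (D X Y)
  add_left : ∀ X X' Y, IsVectorField X → IsVectorField X' → IsVectorField Y →
    ∀ x ∈ manifold n p, D (X + X') Y x = D X Y x + D X' Y x
  smul_left : ∀ (f : Ambient n p → ℝ) (X Y), ContDiff ℝ ∞ f → IsVectorField X → IsVectorField Y →
    ∀ x ∈ manifold n p, D (f • X) Y x = f x • D X Y x
  add_right : ∀ X Y Y', IsVectorField X → IsVectorField Y → IsVectorField Y' →
    ∀ x ∈ manifold n p, D X (Y + Y') x = D X Y x + D X Y' x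
  leibniz : ∀ (f : Ambient n p → ℝ) (X Y), ContDiff ℝ ∞ f → IsVectorField X → IsVectorField Y →
    ∀ x ∈ manifold n p, D X (f • Y) x = fderiv ℝ f x (X x) • Y x + f x • D X Y x
  metric_compatible : ∀ X Y Z, IsVectorField X → IsVectorField Y → IsVectorField Z →
    ∀ x ∈ manifold n p, fderiv ℝ (fun y => metric a c y (Y y) (Z y)) x (X x) =
      metric a c x (D X Y x) (Z x) + metric a c x (Y x) (D X Z x)
  torsion_free : ∀ X Y, IsVectorField X → IsVectorField Y →
    ∀ x ∈ manifold n p, D X Y x - D Y X x = VectorField.lieBracket ℝ X Y x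

/-- The curvature `R(X, Y) Z = D_X D_Y Z - D_Y D_X Z - D_[X, Y] Z` of a connection. -/
def curvature
    (D : (Ambient n p → Ambient n p) → (Ambient n p → Ambient n p) → Ambient n p → Ambient n p)
    (X Y Z : Ambient n p → Ambient n p) : Ambient n p → Ambient n p :=
  D X (D Y Z) - D Y (D X Z) - D (VectorField.lieBracket ℝ X Y) Z

/-! ### The homogeneous space structure and the orthonormal basis -/

/-- The base point `o = (e_0, e_0)` of `U(n+1)/U(n) × U(p+1)/U(p)`. -/
def basePoint (n p : ℕ) : Ambient n p :=
  (EuclideanSpace.single 0 1, EuclideanSpace.single 0 1)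

/-- The matrix `E_νμ` with `1` at the place `(ν, μ)`, rows and columns numbered `0, …, n`. -/
def matE (n ν μ : ℕ) : Matrix (Fin (n + 1)) (Fin (n + 1)) ℂ :=
  fun i j => if (i : ℕ) = ν ∧ (j : ℕ) = μ then 1 else 0

/-- `Z_νμ = E_νμ - E_μν`. -/
def matZ (n ν μ : ℕ) : Matrix (Fin (n + 1)) (Fin (n + 1)) ℂ := matE n ν μ - matE n μ ν

/-- `T_νμ = E_νμ + E_μν`. -/
def matT (n ν μ : ℕ) : Matrix (Fin (n + 1)) (Fin (n + 1)) ℂ := matE n ν μ + matE n μ ν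

/-- `X = (1/2) i T_00`. -/
def matX (n : ℕ) : Matrix (Fin (n + 1)) (Fin (n + 1)) ℂ := ((1 / 2 : ℂ) * Complex.I) • matT n 0 0

/-- `Y_(2ν-1) = Z_ν0` and `Y_(2ν) = i T_ν0`, for `1 ≤ ν ≤ n`. -/
def matY (n k : ℕ) : Matrix (Fin (n + 1)) (Fin (n + 1)) ℂ :=
  if Odd k then matZ n ((k + 1) / 2) 0 else Complex.I • matT n (k / 2) 0

/-- The basis `Z_0, …, Z_(2n+2p+1)` of the complement `𝔭` of `𝔲(n) × 𝔲(p)` in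
`𝔲(n+1) × 𝔲(p+1)`: `Z_0 = √c X¹`, `Z_ν = Y¹_ν` for `1 ≤ ν ≤ 2n`,
`Z_(2n+1) = (a/√c) X¹ + (1/√c) X²`, `Z_(2n+1+μ) = Y²_μ` for `1 ≤ μ ≤ 2p`. -/
def basisElt (n p : ℕ) (a c : ℝ) (k : ℕ) :
    Matrix (Fin (n + 1)) (Fin (n + 1)) ℂ × Matrix (Fin (p + 1)) (Fin (p + 1)) ℂ :=
  if k = 0 then (Real.sqrt c • matX n, 0)
  else if k ≤ 2 * n then (matY n k, 0)
  else if k = 2 * n + 1 then ((a / Real.sqrt c) • matX n, (1 / Real.sqrt c) • matX p)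
  else (0, matY p (k - (2 * n + 1)))

/-- The vector `A · x` at `x`, the velocity at `t = 0` of the curve `exp (t A) x`; for `x = o` this
is the identification of `𝔭` with the tangent space at `o`. -/
def action (A : Matrix (Fin (n + 1)) (Fin (n + 1)) ℂ × Matrix (Fin (p + 1)) (Fin (p + 1)) ℂ)
    (x : Ambient n p) : Ambient n p :=
  (Matrix.toEuclideanLin A.1 x.1, Matrix.toEuclideanLin A.2 x.2)

/-- The vector fields `Z k` extend the basis `Z_0, …, Z_(2n+2p+1)` of `𝔭`, identified with the
tangent space at the base point, to `S^(2n+1) × S^(2p+1)`. -/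
def IsFrame (a c : ℝ) (Z : ℕ → Ambient n p → Ambient n p) : Prop :=
  ∀ k ≤ 2 * n + 2 * p + 1, IsVectorField (Z k) ∧
    Z k (basePoint n p) = action (basisElt n p a c k) (basePoint n p)

/-- `R_((α ν) (ρ μ)) = ⟨R(Z_α, Z_ν) Z_μ, Z_ρ⟩` at the base point. -/
def component (a c : ℝ)
    (D : (Ambient n p → Ambient n p) → (Ambient n p → Ambient n p) → Ambient n p → Ambient n p)
    (Z : ℕ → Ambient n p → Ambient n p) (α ν ρ μ : ℕ) : ℝ :=
  metric a c (basePoint n p) (curvature D (Z α) (Z ν) (Z μ) (basePoint n p)) (Z ρ (basePoint n p))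

end SphereProduct

end

/-!
The metric `g(a,c)` differs from the product of the round metrics only along the fibre directions,
by a constant quadratic form `q` in the fibre forms `θ₁ = fib₁`, `θ₂ = fib₂`, where
`q₁₁ = 1/c - 1`, `q₁₂ = -a/c`, `q₂₂ = (a² + c²)/c - 1`. Since the exterior derivative of `θ_j` is
given by `Im ⟨u_j, v_j⟩`, the Koszul formula can be solved explicitly: the Levi-Civita connection is
the flat derivative of the ambient space plus the tensor `Γ` with components
`Re ⟨u_j, v_j⟩ x_j + i (α_j(v) hor_j u + α_j(u) hor_j v)`, where `α_j = ∑ q_ij θ_i`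
(`christoffel`, with `α_j` called `weight₁`, `weight₂`). `IsLeviCivita.eq_connection` shows that any
Levi-Civita connection agrees with this formula on the product of spheres, because the difference of
two Levi-Civita connections is symmetric in one pair of arguments and antisymmetric in another.

Derivatives along tangent vectors see only the values on the submanifold
(`fderiv_apply_eq_of_eqOn`), so the formula may be inserted into itself, and the curvature becomes
`(∂_u Γ)(v, y) - (∂_v Γ)(u, y) + Γ(u, Γ(v, y)) - Γ(v, Γ(u, y))` (`IsLeviCivita.curvature_eq`). For
`u`, `v` horizontal in the first factor and `y` horizontal in the second, the quadratic terms vanish,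
and the second component of the derivative terms comes only from
`∂_u α₂(v) = q₁₂ Im ⟨u₁, v₁⟩`. Pairing with a horizontal `w` of the second factor gives
`-(2a/c) Im ⟨u₁, v₁⟩ Im ⟨y₂, w₂⟩` (`extMetric_curvatureTensor`), which on the basis vectors is
nonzero only for pairs belonging to one complex coordinate.
-/

noncomputable section

namespace SphereProduct

/-! ### The contribution of one sphere to the Christoffel tensor -/

section Factor

variable {E : Type*} [NormedAddCommGroup E] [InnerProductSpace ℂ E]

/-- One component of the Christoffel tensor: the second fundamental form of the unit sphere at `z`
plus `i` times the horizontal parts of `u` and `v`, each weighted by the fibre weight (`s` for `u`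
and `t` for `v`) of the other vector. The scalars are written in `ℂ`, so that the term is a
`ℂ`-linear combination of `z`, `u` and `v`. -/
def christoffelFactor (s t : ℝ) (z u v : E) : E :=
  ((inner ℂ u v : ℂ).re : ℂ) • z + ((t : ℂ) * Complex.I) • (u - (inner ℂ z u : ℂ) • z) +
    ((s : ℂ) * Complex.I) • (v - (inner ℂ z v : ℂ) • z)

/-- The part of the derivative of `christoffelFactor` that comes from moving `z` in the direction
`z'`; here `s'` and `t'` are the derivatives of the weights `s` and `t`. -/
def christoffelFactorDeriv (s t s' t' : ℝ) (z z' u v : E) : E :=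
  ((inner ℂ u v : ℂ).re : ℂ) • z' + ((t' : ℂ) * Complex.I) • (u - (inner ℂ z u : ℂ) • z) +
    ((s' : ℂ) * Complex.I) • (v - (inner ℂ z v : ℂ) • z) -
    ((t : ℂ) * Complex.I) • ((inner ℂ z' u : ℂ) • z + (inner ℂ z u : ℂ) • z') -
    ((s : ℂ) * Complex.I) • ((inner ℂ z' v : ℂ) • z + (inner ℂ z v : ℂ) • z')

theorem christoffelFactor_symm (s t : ℝ) (z u v : E) :
    christoffelFactor s t z u v = christoffelFactor t s z v u := by
  have h : (inner ℂ u v : ℂ).re = (inner ℂ v u : ℂ).re := inner_re_symm (𝕜 := ℂ) u v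
  simp only [christoffelFactor, h]
  abel

theorem christoffelFactor_add_right (s t t' : ℝ) (z u v v' : E) :
    christoffelFactor s (t + t') z u (v + v') =
      christoffelFactor s t z u v + christoffelFactor s t' z u v' := by
  simp only [christoffelFactor, inner_add_right, Complex.add_re, Complex.ofReal_add]
  module

theorem hasDerivAt_re {f : ℝ → ℂ} {f' : ℂ} {r : ℝ} (hf : HasDerivAt f f' r) :
    HasDerivAt (fun t => (f t).re) f'.re r :=
  Complex.reCLM.hasFDerivAt.comp_hasDerivAt r hf

theorem hasDerivAt_im {f : ℝ → ℂ} {f' : ℂ} {r : ℝ} (hf : HasDerivAt f f' r) :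
    HasDerivAt (fun t => (f t).im) f'.im r :=
  Complex.imCLM.hasFDerivAt.comp_hasDerivAt r hf

theorem hasDerivAt_christoffelFactor [NormedSpace ℝ E] [IsScalarTower ℝ ℂ E] {s t : ℝ → ℝ}
    {s' t' : ℝ} {z u v : ℝ → E} {z' u' v' : E} {r : ℝ} {σ τ : ℝ}
    (hs : HasDerivAt s (s' + σ) r) (ht : HasDerivAt t (t' + τ) r)
    (hz : HasDerivAt z z' r) (hu : HasDerivAt u u' r) (hv : HasDerivAt v v' r) :
    HasDerivAt (fun r => christoffelFactor (s r) (t r) (z r) (u r) (v r))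
      (christoffelFactorDeriv (s r) (t r) s' t' (z r) z' (u r) (v r) +
        christoffelFactor σ (t r) (z r) u' (v r) + christoffelFactor (s r) τ (z r) (u r) v') r := by
  have key := (((hasDerivAt_re (hu.inner ℂ hv)).ofReal_comp.smul hz).add
    ((ht.ofReal_comp.mul_const Complex.I).smul (hu.sub ((hz.inner ℂ hu).smul hz)))).add
    ((hs.ofReal_comp.mul_const Complex.I).smul (hv.sub ((hz.inner ℂ hv).smul hz)))
  refine (key.congr_deriv ?_)
  simp only [christoffelFactorDeriv, christoffelFactor, Complex.add_re, Pi.sub_apply,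
    Pi.smul_apply',
    Complex.ofReal_add]
  module

variable {z u v w : E}

/-- On the unit sphere only the second fundamental form term has a component along `z`. -/
theorem inner_christoffelFactor_self (hz : ‖z‖ = 1) (s t : ℝ) (u v : E) :
    (inner ℂ z (christoffelFactor s t z u v) : ℂ) = ((inner ℂ u v : ℂ).re : ℂ) := by
  have h : (inner ℂ z z : ℂ) = 1 := by simp [inner_self_eq_norm_sq_to_K, hz]
  simp only [christoffelFactor, inner_add_right, inner_sub_right, inner_smul_right, h]
  ring

theorem re_inner_christoffelFactor (hu : (inner ℂ z u : ℂ).re = 0) (hv : (inner ℂ z v : ℂ).re = 0)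
    (hw : (inner ℂ z w : ℂ).re = 0) (s t : ℝ) :
    (inner ℂ (christoffelFactor s t z u v) w : ℂ).re =
      t * (inner ℂ u w : ℂ).im + s * (inner ℂ v w : ℂ).im := by
  simp only [christoffelFactor, inner_add_left, inner_sub_left, inner_smul_left, map_mul,
    Complex.conj_ofReal, Complex.conj_I, Complex.add_re, Complex.mul_re, Complex.mul_im,
    Complex.sub_re, Complex.sub_im, Complex.ofReal_re, Complex.ofReal_im, Complex.conj_re,
    Complex.conj_im, Complex.neg_re, Complex.neg_im, Complex.I_re, Complex.I_im, hu, hv, hw]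
  ring

theorem inner_self_re (u : E) : (inner ℂ u u : ℂ).re = ‖u‖ ^ 2 := by
  simpa using inner_self_eq_norm_sq (𝕜 := ℂ) u

/-- The Cauchy–Schwarz inequality for a unit vector and the imaginary part of the Hermitian
product. -/
theorem sq_im_inner_le (hz : ‖z‖ = 1) (u : E) :
    (inner ℂ z u : ℂ).im ^ 2 ≤ (inner ℂ u u : ℂ).re := by
  have h1 : |(inner ℂ z u : ℂ).im| ≤ ‖u‖ :=
    (Complex.abs_im_le_norm _).trans (by simpa [hz] using norm_inner_le_norm (𝕜 := ℂ) z u)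
  rw [inner_self_re]
  exact sq_le_sq.mpr (by simpa using h1)

end Factor

/-! ### Derivatives along the submanifold -/

section Sphere

variable {E : Type*} [NormedAddCommGroup E] [InnerProductSpace ℂ E] [NormedSpace ℝ E]

/-- A tangent vector of the unit sphere, doubled, is the velocity of a curve on the sphere; the
curve is the rational parametrization of a great circle. -/
theorem exists_curve_on_sphere [IsScalarTower ℝ ℂ E] {z u : E} (hz : ‖z‖ = 1)
    (hu : (inner ℂ z u : ℂ).re = 0) :
    ∃ γ : ℝ → E, γ 0 = z ∧ (∀ t, ‖γ t‖ = 1) ∧ HasDerivAt γ ((2 : ℝ) • u) 0 := by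
  have hpos : ∀ t : ℝ, 0 < 1 + t ^ 2 * ‖u‖ ^ 2 := fun t => by positivity
  refine ⟨fun t => ((1 - t ^ 2 * ‖u‖ ^ 2) / (1 + t ^ 2 * ‖u‖ ^ 2)) • z +
    ((2 * t) / (1 + t ^ 2 * ‖u‖ ^ 2)) • u, by simp, fun t => ?_, ?_⟩
  · have hu' : (inner ℂ u z : ℂ).re = 0 := (inner_re_symm (𝕜 := ℂ) u z).trans hu
    rw [← sq_eq_sq₀ (norm_nonneg _) zero_le_one, ← inner_self_re]
    simp only [← algebraMap_smul ℂ (_ : ℝ) (_ : E), Complex.coe_algebraMap, inner_add_left,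
      inner_add_right, inner_smul_left, inner_smul_right, Complex.conj_ofReal, Complex.add_re,
      Complex.re_ofReal_mul, inner_self_re, hz, hu, hu']
    have := (hpos t).ne'
    field_simp
    ring
  · have hq : HasDerivAt (fun t : ℝ => t ^ 2 * ‖u‖ ^ 2) 0 0 := by
      simpa using (hasDerivAt_pow 2 (0 : ℝ)).mul_const (‖u‖ ^ 2)
    have hd := hq.const_add 1
    have h1 := ((hq.const_sub 1).div hd (hpos 0).ne').smul_const z
    have h2 := (((hasDerivAt_id (0 : ℝ)).const_mul 2).div hd (hpos 0).ne').smul_const u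
    refine (h1.add h2).congr_deriv ?_
    simp

end Sphere

variable {n p : ℕ}

theorem norm_fst_of_mem {x : Ambient n p} (hx : x ∈ manifold n p) : ‖x.1‖ = 1 := by
  simpa using hx.1

theorem norm_snd_of_mem {x : Ambient n p} (hx : x ∈ manifold n p) : ‖x.2‖ = 1 := by
  simpa using hx.2

/-- The derivative of a map in a tangent direction depends only on the restriction of the map to
`S^(2n+1) × S^(2p+1)`. -/
theorem fderiv_apply_eq_of_eqOn {G : Type*} [NormedAddCommGroup G] [NormedSpace ℝ G]
    {F F' : Ambient n p → G} (h : Set.EqOn F F' (manifold n p)) {x u : Ambient n p}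
    (hF : DifferentiableAt ℝ F x) (hF' : DifferentiableAt ℝ F' x) (hx : x ∈ manifold n p)
    (hu : u ∈ tangent x) : fderiv ℝ F x u = fderiv ℝ F' x u := by
  obtain ⟨γ, hγ, hγn, hγd⟩ := exists_curve_on_sphere (norm_fst_of_mem hx) hu.1
  obtain ⟨δ, hδ, hδn, hδd⟩ := exists_curve_on_sphere (norm_snd_of_mem hx) hu.2
  have hc : HasDerivAt (fun t => ((γ t, δ t) : Ambient n p)) ((2 : ℝ) • u) 0 := hγd.prodMk hδd
  have hc0 : ((γ 0, δ 0) : Ambient n p) = x := by rw [hγ, hδ]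
  have d1 := HasFDerivAt.comp_hasDerivAt (f := fun t => ((γ t, δ t) : Ambient n p)) (0 : ℝ)
    (hc0 ▸ hF.hasFDerivAt) hc
  have d2 := HasFDerivAt.comp_hasDerivAt (f := fun t => ((γ t, δ t) : Ambient n p)) (0 : ℝ)
    (hc0 ▸ hF'.hasFDerivAt) hc
  have he : F ∘ (fun t => ((γ t, δ t) : Ambient n p)) = F' ∘ fun t => (γ t, δ t) :=
    funext fun t => h (by simp [manifold, hγn, hδn])
  rw [he] at d1
  have := d1.unique d2
  rw [hc0, map_smul, map_smul] at this
  exact smul_right_injective G (two_ne_zero (α := ℝ)) this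

/-! ### The metric on tangent vectors -/

/-- First component of the covector dual to the fibre part of `u` for the difference of the metric
`g(a,c)` and the round metric. -/
def weight₁ (a c : ℝ) (x u : Ambient n p) : ℝ := (1 / c - 1) * fib₁ x u - a / c * fib₂ x u

/-- Second component of the covector dual to the fibre part of `u` for the difference of the metric
`g(a,c)` and the round metric. -/
def weight₂ (a c : ℝ) (x u : Ambient n p) : ℝ :=
  -(a / c) * fib₁ x u + ((a ^ 2 + c ^ 2) / c - 1) * fib₂ x u

/-- A bilinear form on the ambient space that restricts to `g(a,c)` on the tangent spaces of
`S^(2n+1) × S^(2p+1)`: the Euclidean product plus a correction in the fibre directions. -/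
def extMetric (a c : ℝ) (x u v : Ambient n p) : ℝ :=
  (inner ℂ u.1 v.1 : ℂ).re + (inner ℂ u.2 v.2 : ℂ).re +
    (weight₁ a c x u * fib₁ x v + weight₂ a c x u * fib₂ x v)

theorem metric_eq_extMetric {a c : ℝ} {x u v : Ambient n p} (hx : x ∈ manifold n p)
    (hu : u ∈ tangent x) (hv : v ∈ tangent x) : metric a c x u v = extMetric a c x u v := by
  have h1 : (inner ℂ x.1 x.1 : ℂ) = 1 := by simp [inner_self_eq_norm_sq_to_K, norm_fst_of_mem hx]
  have h2 : (inner ℂ x.2 x.2 : ℂ) = 1 := by simp [inner_self_eq_norm_sq_to_K, norm_snd_of_mem hx]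
  have e1 : (inner ℂ u.1 x.1 : ℂ) = (starRingEnd ℂ) (inner ℂ x.1 u.1) :=
    (inner_conj_symm _ _).symm
  have e2 : (inner ℂ u.2 x.2 : ℂ) = (starRingEnd ℂ) (inner ℂ x.2 u.2) :=
    (inner_conj_symm _ _).symm
  obtain ⟨hu1, hu2⟩ := hu
  obtain ⟨hv1, hv2⟩ := hv
  simp only [metric, form, cplx, hor₁, hor₂, extMetric, weight₁, weight₂, fib₁, fib₂,
    inner_add_right, inner_sub_right, inner_sub_left, inner_smul_right, inner_smul_left, h1, h2,
    e1, e2, Complex.add_re, Complex.add_im, Complex.sub_re, Complex.sub_im, Complex.mul_re,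
    Complex.mul_im, Complex.ofReal_re, Complex.ofReal_im, Complex.I_re, Complex.I_im,
    Complex.conj_re, Complex.conj_im, Complex.one_re, Complex.one_im, hu1, hu2, hv1, hv2]
  ring

theorem extMetric_symm (a c : ℝ) (x u v : Ambient n p) :
    extMetric a c x u v = extMetric a c x v u := by
  have h1 : (inner ℂ u.1 v.1 : ℂ).re = (inner ℂ v.1 u.1 : ℂ).re := inner_re_symm (𝕜 := ℂ) _ _
  have h2 : (inner ℂ u.2 v.2 : ℂ).re = (inner ℂ v.2 u.2 : ℂ).re := inner_re_symm (𝕜 := ℂ) _ _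
  simp only [extMetric, weight₁, weight₂, h1, h2]
  ring

theorem extMetric_sub_left (a c : ℝ) (x u u' v : Ambient n p) :
    extMetric a c x (u - u') v = extMetric a c x u v - extMetric a c x u' v := by
  simp only [extMetric, weight₁, weight₂, fib₁, fib₂, Prod.fst_sub, Prod.snd_sub, inner_sub_left,
    inner_sub_right, Complex.sub_re, Complex.sub_im]
  ring

theorem extMetric_definite {a c : ℝ} (hc : 0 < c) {x u : Ambient n p} (hx : x ∈ manifold n p)
    (h : extMetric a c x u u = 0) : u = 0 := by
  have h1 := sq_im_inner_le (norm_fst_of_mem hx) u.1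
  have h2 := sq_im_inner_le (norm_snd_of_mem hx) u.2
  -- Completing the square in the fibre part of the metric.
  have h3 : ((inner ℂ u.1 u.1 : ℂ).re - fib₁ x u ^ 2) + ((inner ℂ u.2 u.2 : ℂ).re - fib₂ x u ^ 2) +
      ((fib₁ x u - a * fib₂ x u) ^ 2 / c + c * fib₂ x u ^ 2) = 0 := by
    rw [← h, extMetric, weight₁, weight₂]
    field_simp
    ring
  have h4 : 0 ≤ (fib₁ x u - a * fib₂ x u) ^ 2 / c := by positivity
  have h5 : 0 ≤ c * fib₂ x u ^ 2 := by positivity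
  change fib₁ x u ^ 2 ≤ _ at h1
  change fib₂ x u ^ 2 ≤ _ at h2
  have h6 : fib₂ x u = 0 := by
    have : c * fib₂ x u ^ 2 = 0 := by linarith
    simpa [hc.ne'] using this
  have h7 : fib₁ x u = 0 := by
    have : (fib₁ x u - a * fib₂ x u) ^ 2 / c = 0 := by linarith
    simpa [hc.ne', h6] using this
  rw [h6, h7, inner_self_re, inner_self_re] at h3
  have h8' : ‖u.1‖ ^ 2 + ‖u.2‖ ^ 2 = 0 := by simpa using h3
  have h8 : ‖u.1‖ = 0 := by
    rw [← sq_eq_zero_iff]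
    linarith [sq_nonneg ‖u.1‖, sq_nonneg ‖u.2‖]
  have h9 : ‖u.2‖ = 0 := by
    rw [← sq_eq_zero_iff]
    linarith [sq_nonneg ‖u.1‖, sq_nonneg ‖u.2‖]
  exact Prod.ext (norm_eq_zero.mp h8) (norm_eq_zero.mp h9)

/-! ### An explicit Levi-Civita connection -/

/-- The Christoffel tensor of `g(a,c)`: the Levi-Civita connection differs by it from the flat
derivative of the ambient space. -/
def christoffel (a c : ℝ) (x u v : Ambient n p) : Ambient n p :=
  (christoffelFactor (weight₁ a c x u) (weight₁ a c x v) x.1 u.1 v.1,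
   christoffelFactor (weight₂ a c x u) (weight₂ a c x v) x.2 u.2 v.2)

/-- The derivative of `christoffel a c x u v` in `x` in the direction `x'`, with `u` and `v`
fixed. -/
def christoffelDeriv (a c : ℝ) (x x' u v : Ambient n p) : Ambient n p :=
  (christoffelFactorDeriv (weight₁ a c x u) (weight₁ a c x v) (weight₁ a c x' u)
      (weight₁ a c x' v) x.1 x'.1 u.1 v.1,
   christoffelFactorDeriv (weight₂ a c x u) (weight₂ a c x v) (weight₂ a c x' u)
      (weight₂ a c x' v) x.2 x'.2 u.2 v.2)

theorem christoffel_symm (a c : ℝ) (x u v : Ambient n p) :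
    christoffel a c x u v = christoffel a c x v u :=
  Prod.ext (christoffelFactor_symm ..) (christoffelFactor_symm ..)

theorem christoffel_add_right (a c : ℝ) (x u v v' : Ambient n p) :
    christoffel a c x u (v + v') = christoffel a c x u v + christoffel a c x u v' := by
  have h1 : weight₁ a c x (v + v') = weight₁ a c x v + weight₁ a c x v' := by
    simp [weight₁, fib₁, fib₂]; ring
  have h2 : weight₂ a c x (v + v') = weight₂ a c x v + weight₂ a c x v' := by
    simp [weight₂, fib₁, fib₂]; ring
  simp only [christoffel, h1, h2, Prod.fst_add, Prod.snd_add, christoffelFactor_add_right,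
    Prod.mk_add_mk]

theorem christoffel_sub_left (a c : ℝ) (x u u' v : Ambient n p) :
    christoffel a c x (u - u') v = christoffel a c x u v - christoffel a c x u' v := by
  rw [eq_sub_iff_add_eq, christoffel_symm, christoffel_symm a c x u', ← christoffel_add_right,
    sub_add_cancel, christoffel_symm]

section Deriv

variable {a c : ℝ} {x u v : ℝ → Ambient n p} {x' u' v' : Ambient n p} {r : ℝ}

theorem hasDerivAt_fst {E F : Type*} [NormedAddCommGroup E] [NormedSpace ℝ E]
    [NormedAddCommGroup F] [NormedSpace ℝ F] {f : ℝ → E × F} {f' : E × F}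
    (h : HasDerivAt f f' r) : HasDerivAt (fun t => (f t).1) f'.1 r :=
  (ContinuousLinearMap.fst ℝ E F).hasFDerivAt.comp_hasDerivAt r h

theorem hasDerivAt_snd {E F : Type*} [NormedAddCommGroup E] [NormedSpace ℝ E]
    [NormedAddCommGroup F] [NormedSpace ℝ F] {f : ℝ → E × F} {f' : E × F}
    (h : HasDerivAt f f' r) : HasDerivAt (fun t => (f t).2) f'.2 r :=
  (ContinuousLinearMap.snd ℝ E F).hasFDerivAt.comp_hasDerivAt r h

theorem hasDerivAt_fib₁ (hx : HasDerivAt x x' r) (hu : HasDerivAt u u' r) :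
    HasDerivAt (fun t => fib₁ (x t) (u t)) (fib₁ x' (u r) + fib₁ (x r) u') r := by
  refine (hasDerivAt_im ((hasDerivAt_fst hx).inner ℂ (hasDerivAt_fst hu))).congr_deriv ?_
  rw [Complex.add_im, add_comm, fib₁, fib₁]

theorem hasDerivAt_fib₂ (hx : HasDerivAt x x' r) (hu : HasDerivAt u u' r) :
    HasDerivAt (fun t => fib₂ (x t) (u t)) (fib₂ x' (u r) + fib₂ (x r) u') r := by
  refine (hasDerivAt_im ((hasDerivAt_snd hx).inner ℂ (hasDerivAt_snd hu))).congr_deriv ?_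
  rw [Complex.add_im, add_comm, fib₂, fib₂]

theorem hasDerivAt_weight₁ (hx : HasDerivAt x x' r) (hu : HasDerivAt u u' r) :
    HasDerivAt (fun t => weight₁ a c (x t) (u t)) (weight₁ a c x' (u r) + weight₁ a c (x r) u')
      r := by
  refine (((hasDerivAt_fib₁ hx hu).const_mul _).sub
    ((hasDerivAt_fib₂ hx hu).const_mul _)).congr_deriv ?_
  simp only [weight₁]
  ring

theorem hasDerivAt_weight₂ (hx : HasDerivAt x x' r) (hu : HasDerivAt u u' r) :
    HasDerivAt (fun t => weight₂ a c (x t) (u t)) (weight₂ a c x' (u r) + weight₂ a c (x r) u')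
      r := by
  refine (((hasDerivAt_fib₁ hx hu).const_mul _).add
    ((hasDerivAt_fib₂ hx hu).const_mul _)).congr_deriv ?_
  simp only [weight₂]
  ring

theorem hasDerivAt_christoffel (hx : HasDerivAt x x' r) (hu : HasDerivAt u u' r)
    (hv : HasDerivAt v v' r) :
    HasDerivAt (fun t => christoffel a c (x t) (u t) (v t))
      (christoffelDeriv a c (x r) x' (u r) (v r) + christoffel a c (x r) u' (v r) +
        christoffel a c (x r) (u r) v') r :=
  (hasDerivAt_christoffelFactor (hasDerivAt_weight₁ hx hu) (hasDerivAt_weight₁ hx hv)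
    (hasDerivAt_fst hx) (hasDerivAt_fst hu) (hasDerivAt_fst hv)).prodMk
  (hasDerivAt_christoffelFactor (hasDerivAt_weight₂ hx hu) (hasDerivAt_weight₂ hx hv)
    (hasDerivAt_snd hx) (hasDerivAt_snd hu) (hasDerivAt_snd hv))

theorem hasDerivAt_extMetric (hx : HasDerivAt x x' r) (hu : HasDerivAt u u' r)
    (hv : HasDerivAt v v' r) :
    HasDerivAt (fun t => extMetric a c (x t) (u t) (v t))
      (extMetric a c (x r) u' (v r) + extMetric a c (x r) (u r) v' +
        (weight₁ a c (x r) (u r) * fib₁ x' (v r) + weight₁ a c (x r) (v r) * fib₁ x' (u r) +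
          weight₂ a c (x r) (u r) * fib₂ x' (v r) + weight₂ a c (x r) (v r) * fib₂ x' (u r)))
      r := by
  refine (((hasDerivAt_re ((hasDerivAt_fst hu).inner ℂ (hasDerivAt_fst hv))).add
    (hasDerivAt_re ((hasDerivAt_snd hu).inner ℂ (hasDerivAt_snd hv)))).add
    (((hasDerivAt_weight₁ hx hu).mul (hasDerivAt_fib₁ hx hv)).add
      ((hasDerivAt_weight₂ hx hu).mul (hasDerivAt_fib₂ hx hv)))).congr_deriv ?_
  simp only [extMetric, Complex.add_re, weight₁, weight₂]
  ring

end Deriv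

section ContDiff

variable {X Y Z : Ambient n p → Ambient n p}

theorem contDiff_fib₁ (hX : ContDiff ℝ ∞ X) (hY : ContDiff ℝ ∞ Y) :
    ContDiff ℝ ∞ fun x => fib₁ (X x) (Y x) :=
  Complex.imCLM.contDiff.comp (hX.fst.inner ℂ hY.fst)

theorem contDiff_fib₂ (hX : ContDiff ℝ ∞ X) (hY : ContDiff ℝ ∞ Y) :
    ContDiff ℝ ∞ fun x => fib₂ (X x) (Y x) :=
  Complex.imCLM.contDiff.comp (hX.snd.inner ℂ hY.snd)

theorem contDiff_hor₁ (hX : ContDiff ℝ ∞ X) (hY : ContDiff ℝ ∞ Y) :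
    ContDiff ℝ ∞ fun x => hor₁ (X x) (Y x) :=
  hY.fst.sub ((hX.fst.inner ℂ hY.fst).smul hX.fst)

theorem contDiff_hor₂ (hX : ContDiff ℝ ∞ X) (hY : ContDiff ℝ ∞ Y) :
    ContDiff ℝ ∞ fun x => hor₂ (X x) (Y x) :=
  hY.snd.sub ((hX.snd.inner ℂ hY.snd).smul hX.snd)

theorem contDiff_weight₁ (a c : ℝ) (hX : ContDiff ℝ ∞ X) (hY : ContDiff ℝ ∞ Y) :
    ContDiff ℝ ∞ fun x => weight₁ a c (X x) (Y x) :=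
  (contDiff_const.mul (contDiff_fib₁ hX hY)).sub (contDiff_const.mul (contDiff_fib₂ hX hY))

theorem contDiff_weight₂ (a c : ℝ) (hX : ContDiff ℝ ∞ X) (hY : ContDiff ℝ ∞ Y) :
    ContDiff ℝ ∞ fun x => weight₂ a c (X x) (Y x) :=
  (contDiff_const.mul (contDiff_fib₁ hX hY)).add (contDiff_const.mul (contDiff_fib₂ hX hY))

theorem contDiff_cplx (a c : ℝ) (hX : ContDiff ℝ ∞ X) (hY : ContDiff ℝ ∞ Y) :
    ContDiff ℝ ∞ fun x => cplx a c (X x) (Y x) := by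
  have h1 := contDiff_fib₁ hX hY
  have h2 := contDiff_fib₂ hX hY
  have hI : ContDiff ℝ ∞ fun _ : Ambient n p => Complex.I := contDiff_const
  exact ((hI.smul (contDiff_hor₁ hX hY)).add
      ((Complex.ofRealCLM.contDiff.comp ((contDiff_const.mul h1).sub (contDiff_const.mul h2))).smul
        (hI.smul hX.fst))).prodMk
    ((hI.smul (contDiff_hor₂ hX hY)).add
      ((Complex.ofRealCLM.contDiff.comp ((contDiff_const.mul h1).sub (contDiff_const.mul h2))).smul
        (hI.smul hX.snd)))

theorem contDiff_metric (a c : ℝ) (hX : ContDiff ℝ ∞ X) (hY : ContDiff ℝ ∞ Y)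
    (hZ : ContDiff ℝ ∞ Z) : ContDiff ℝ ∞ fun x => metric a c (X x) (Y x) (Z x) := by
  have hW := contDiff_cplx a c hX hZ
  exact ((((contDiff_fib₁ hX hY).mul (contDiff_fib₂ hX hW)).sub
    ((contDiff_fib₂ hX hY).mul (contDiff_fib₁ hX hW))).add
    (Complex.imCLM.contDiff.comp ((contDiff_hor₁ hX hY).inner ℂ (contDiff_hor₁ hX hW)))).add
    (Complex.imCLM.contDiff.comp ((contDiff_hor₂ hX hY).inner ℂ (contDiff_hor₂ hX hW)))

theorem contDiff_extMetric (a c : ℝ) (hX : ContDiff ℝ ∞ X) (hY : ContDiff ℝ ∞ Y)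
    (hZ : ContDiff ℝ ∞ Z) : ContDiff ℝ ∞ fun x => extMetric a c (X x) (Y x) (Z x) :=
  ((Complex.reCLM.contDiff.comp (hY.fst.inner ℂ hZ.fst)).add
    (Complex.reCLM.contDiff.comp (hY.snd.inner ℂ hZ.snd))).add
    (((contDiff_weight₁ a c hX hY).mul (contDiff_fib₁ hX hZ)).add
      ((contDiff_weight₂ a c hX hY).mul (contDiff_fib₂ hX hZ)))

theorem contDiff_christoffel (a c : ℝ) (hX : ContDiff ℝ ∞ X) (hY : ContDiff ℝ ∞ Y)
    (hZ : ContDiff ℝ ∞ Z) : ContDiff ℝ ∞ fun x => christoffel a c (X x) (Y x) (Z x) := by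
  have real {f : Ambient n p → ℝ} (hf : ContDiff ℝ ∞ f) : ContDiff ℝ ∞ fun x => ((f x : ℝ) : ℂ) :=
    Complex.ofRealCLM.contDiff.comp hf
  have re {f : Ambient n p → ℂ} (hf : ContDiff ℝ ∞ f) : ContDiff ℝ ∞ fun x => (f x).re :=
    Complex.reCLM.contDiff.comp hf
  exact ((((real (re (hY.fst.inner ℂ hZ.fst))).smul hX.fst).add
      (((real (contDiff_weight₁ a c hX hZ)).mul contDiff_const).smul (contDiff_hor₁ hX hY))).add
      (((real (contDiff_weight₁ a c hX hY)).mul contDiff_const).smul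
        (contDiff_hor₁ hX hZ))).prodMk
    ((((real (re (hY.snd.inner ℂ hZ.snd))).smul hX.snd).add
      (((real (contDiff_weight₂ a c hX hZ)).mul contDiff_const).smul (contDiff_hor₂ hX hY))).add
      (((real (contDiff_weight₂ a c hX hY)).mul contDiff_const).smul (contDiff_hor₂ hX hZ)))

end ContDiff

/-- The derivative of `Y` in the direction `X` plus the Christoffel term: the Levi-Civita
connection of `g(a,c)`, extended to the ambient space. -/
def connection (a c : ℝ) (X Y : Ambient n p → Ambient n p) (x : Ambient n p) : Ambient n p :=
  fderiv ℝ Y x (X x) + christoffel a c x (X x) (Y x)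

theorem hasDerivAt_line (x u : Ambient n p) : HasDerivAt (fun t : ℝ => x + t • u) u 0 := by
  simpa using ((hasDerivAt_id (0 : ℝ)).smul_const u).const_add x

theorem hasDerivAt_comp_line {G : Type*} [NormedAddCommGroup G] [NormedSpace ℝ G]
    {F : Ambient n p → G} {x : Ambient n p} (hF : DifferentiableAt ℝ F x) (u : Ambient n p) :
    HasDerivAt (fun t : ℝ => F (x + t • u)) (fderiv ℝ F x u) 0 := by
  have hF' : HasFDerivAt F (fderiv ℝ F x) (x + (0 : ℝ) • u) := by simpa using hF.hasFDerivAt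
  exact hF'.comp_hasDerivAt (0 : ℝ) (hasDerivAt_line x u)

theorem tangent_sub {x u v : Ambient n p} (hu : u ∈ tangent x) (hv : v ∈ tangent x) :
    u - v ∈ tangent x := by
  obtain ⟨h1, h2⟩ := hu
  obtain ⟨h3, h4⟩ := hv
  constructor <;> simp [*]

theorem IsVectorField.sub {X Y : Ambient n p → Ambient n p} (hX : IsVectorField X)
    (hY : IsVectorField Y) : IsVectorField (X - Y) :=
  ⟨hX.1.sub hY.1, fun x hx => tangent_sub (hX.2 x hx) (hY.2 x hx)⟩

theorem IsVectorField.differentiableAt {X : Ambient n p → Ambient n p} (hX : IsVectorField X)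
    (x : Ambient n p) : DifferentiableAt ℝ X x :=
  hX.1.contDiffAt.differentiableAt (by simp)

theorem contDiff_fderiv_apply {X Y : Ambient n p → Ambient n p} (hX : ContDiff ℝ ∞ X)
    (hY : ContDiff ℝ ∞ Y) : ContDiff ℝ ∞ fun x => fderiv ℝ Y x (X x) :=
  (hY.fderiv_right (by simp)).clm_apply hX

/-- The normal part of the second fundamental form term cancels that of the flat derivative, so
`connection` takes tangent fields to tangent fields. -/
theorem isVectorField_connection (a c : ℝ) {X Y : Ambient n p → Ambient n p}
    (hX : IsVectorField X) (hY : IsVectorField Y) : IsVectorField (connection a c X Y) := by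
  refine ⟨(contDiff_fderiv_apply hX.1 hY.1).add (contDiff_christoffel a c contDiff_id hX.1 hY.1),
    fun x hx => ?_⟩
  have hline := hasDerivAt_line x (X x)
  have hYline := hasDerivAt_comp_line (hY.differentiableAt x) (X x)
  -- The normal parts of the two terms cancel: differentiate the tangency of `Y` along `X`.
  have h1 : (inner ℂ x.1 (fderiv ℝ Y x (X x)).1 : ℂ).re + (inner ℂ (X x).1 (Y x).1 : ℂ).re = 0 := by
    have hs : ContDiff ℝ ∞ fun y : Ambient n p => (inner ℂ y.1 (Y y).1 : ℂ).re :=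
      Complex.reCLM.contDiff.comp (contDiff_fst.inner ℂ hY.1.fst)
    have hd : DifferentiableAt ℝ (fun y : Ambient n p => (inner ℂ y.1 (Y y).1 : ℂ).re) x :=
      hs.contDiffAt.differentiableAt (by simp)
    have e := fderiv_apply_eq_of_eqOn (F' := fun _ => (0 : ℝ)) (fun y hy => (hY.2 y hy).1) hd
      (differentiableAt_const _) hx (hX.2 x hx)
    have e' := (hasDerivAt_comp_line hd (X x)).unique
      (hasDerivAt_re ((hasDerivAt_fst hline).inner ℂ (hasDerivAt_fst hYline)))
    simpa [e] using e'.symm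
  have h2 : (inner ℂ x.2 (fderiv ℝ Y x (X x)).2 : ℂ).re + (inner ℂ (X x).2 (Y x).2 : ℂ).re = 0 := by
    have hs : ContDiff ℝ ∞ fun y : Ambient n p => (inner ℂ y.2 (Y y).2 : ℂ).re :=
      Complex.reCLM.contDiff.comp (contDiff_snd.inner ℂ hY.1.snd)
    have hd : DifferentiableAt ℝ (fun y : Ambient n p => (inner ℂ y.2 (Y y).2 : ℂ).re) x :=
      hs.contDiffAt.differentiableAt (by simp)
    have e := fderiv_apply_eq_of_eqOn (F' := fun _ => (0 : ℝ)) (fun y hy => (hY.2 y hy).2) hd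
      (differentiableAt_const _) hx (hX.2 x hx)
    have e' := (hasDerivAt_comp_line hd (X x)).unique
      (hasDerivAt_re ((hasDerivAt_snd hline).inner ℂ (hasDerivAt_snd hYline)))
    simpa [e] using e'.symm
  constructor
  · simpa [connection, christoffel, inner_add_right,
      inner_christoffelFactor_self (norm_fst_of_mem hx)] using h1
  · simpa [connection, christoffel, inner_add_right,
      inner_christoffelFactor_self (norm_snd_of_mem hx)] using h2

/-- `connection` is torsion-free. -/
theorem connection_sub_connection (a c : ℝ) (X Y : Ambient n p → Ambient n p) (x : Ambient n p) :
    connection a c X Y x - connection a c Y X x = VectorField.lieBracket ℝ X Y x := by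
  rw [connection, connection, christoffel_symm a c x (Y x), VectorField.lieBracket]
  abel

theorem extMetric_add_left (a c : ℝ) (x u u' v : Ambient n p) :
    extMetric a c x (u + u') v = extMetric a c x u v + extMetric a c x u' v := by
  rw [← sub_eq_iff_eq_add, ← extMetric_sub_left, add_sub_cancel_right]

theorem extMetric_christoffel {a c : ℝ} {x u v w : Ambient n p} (hx : x ∈ manifold n p)
    (hu : u ∈ tangent x) (hv : v ∈ tangent x) (hw : w ∈ tangent x) :
    extMetric a c x (christoffel a c x u v) w =
      weight₁ a c x v * fib₁ u w + weight₁ a c x u * fib₁ v w +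
        weight₂ a c x v * fib₂ u w + weight₂ a c x u * fib₂ v w := by
  have h1 : fib₁ x (christoffel a c x u v) = 0 := by
    simp [fib₁, christoffel, inner_christoffelFactor_self (norm_fst_of_mem hx)]
  have h2 : fib₂ x (christoffel a c x u v) = 0 := by
    simp [fib₂, christoffel, inner_christoffelFactor_self (norm_snd_of_mem hx)]
  rw [extMetric, weight₁, weight₂, h1, h2]
  simp only [christoffel, re_inner_christoffelFactor hu.1 hv.1 hw.1,
    re_inner_christoffelFactor hu.2 hv.2 hw.2, fib₁, fib₂]
  ring

theorem fib₁_antisymm (u v : Ambient n p) : fib₁ u v = -fib₁ v u := by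
  rw [fib₁, fib₁, ← inner_conj_symm, Complex.conj_im]

theorem fib₂_antisymm (u v : Ambient n p) : fib₂ u v = -fib₂ v u := by
  rw [fib₂, fib₂, ← inner_conj_symm, Complex.conj_im]

/-- `connection` is metric. The Christoffel terms weighted by the direction `X` cancel because
`fib₁` and `fib₂`, read as forms in two vectors, are alternating. -/
theorem fderiv_metric {a c : ℝ} {X Y Z : Ambient n p → Ambient n p} (hX : IsVectorField X)
    (hY : IsVectorField Y) (hZ : IsVectorField Z) {x : Ambient n p} (hx : x ∈ manifold n p) :
    fderiv ℝ (fun y => metric a c y (Y y) (Z y)) x (X x) =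
      extMetric a c x (connection a c X Y x) (Z x) +
        extMetric a c x (Y x) (connection a c X Z x) := by
  have hd : DifferentiableAt ℝ (fun y => extMetric a c y (Y y) (Z y)) x :=
    (contDiff_extMetric a c contDiff_id hY.1 hZ.1).contDiffAt.differentiableAt (by simp)
  rw [fderiv_apply_eq_of_eqOn (fun y hy => metric_eq_extMetric hy (hY.2 y hy) (hZ.2 y hy))
    ((contDiff_metric a c contDiff_id hY.1 hZ.1).contDiffAt.differentiableAt (by simp)) hd hx
    (hX.2 x hx)]
  have e := (hasDerivAt_comp_line hd (X x)).unique
    (hasDerivAt_extMetric (hasDerivAt_line x (X x))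
      (hasDerivAt_comp_line (hY.differentiableAt x) (X x))
      (hasDerivAt_comp_line (hZ.differentiableAt x) (X x)))
  rw [e, extMetric_symm a c x (Y x), connection, connection, extMetric_add_left,
    extMetric_add_left, extMetric_christoffel hx (hX.2 x hx) (hY.2 x hx) (hZ.2 x hx),
    extMetric_christoffel hx (hX.2 x hx) (hZ.2 x hx) (hY.2 x hx), fib₁_antisymm (Z x),
    fib₂_antisymm (Z x), extMetric_symm a c x (fderiv ℝ Z x (X x))]
  simp only [zero_smul, add_zero]
  ring

/-- Uniqueness of the Levi-Civita connection, in the form needed here: every Levi-Civita connection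
of `g(a,c)` is given by the explicit formula. -/
theorem IsLeviCivita.eq_connection {a c : ℝ} (hc : 0 < c)
    {D : (Ambient n p → Ambient n p) → (Ambient n p → Ambient n p) → Ambient n p → Ambient n p}
    (hD : IsLeviCivita a c D) {X Y : Ambient n p → Ambient n p} (hX : IsVectorField X)
    (hY : IsVectorField Y) : Set.EqOn (D X Y) (connection a c X Y) (manifold n p) := by
  intro x hx
  have symm (X Y) (hX : IsVectorField X) (hY : IsVectorField Y) :
      D X Y x - connection a c X Y x = D Y X x - connection a c Y X x := by
    rw [sub_eq_sub_iff_sub_eq_sub, hD.torsion_free X Y hX hY x hx, connection_sub_connection]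
  have anti (X Y Z) (hX : IsVectorField X) (hY : IsVectorField Y) (hZ : IsVectorField Z) :
      extMetric a c x (D X Y x - connection a c X Y x) (Z x) =
        -extMetric a c x (D X Z x - connection a c X Z x) (Y x) := by
    have h := hD.metric_compatible X Y Z hX hY hZ x hx
    rw [fderiv_metric hX hY hZ hx,
      metric_eq_extMetric hx ((hD.isVectorField X Y hX hY).2 x hx) (hZ.2 x hx),
      metric_eq_extMetric hx (hY.2 x hx) ((hD.isVectorField X Z hX hZ).2 x hx),
      extMetric_symm a c x (Y x), extMetric_symm a c x (Y x)] at h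
    rw [extMetric_sub_left, extMetric_sub_left]
    linarith
  -- A trilinear form symmetric in one pair and antisymmetric in the other pair vanishes.
  have zero (Z) (hZ : IsVectorField Z) :
      extMetric a c x (D X Y x - connection a c X Y x) (Z x) = 0 := by
    have h1 := anti X Y Z hX hY hZ
    have h2 := anti Z X Y hZ hX hY
    have h3 := anti Y Z X hY hZ hX
    rw [symm Z X hZ hX, symm Z Y hZ hY] at h2
    rw [symm Y X hY hX] at h3
    linarith
  exact sub_eq_zero.mp (extMetric_definite hc hx (zero (D X Y - connection a c X Y)
    ((hD.isVectorField X Y hX hY).sub (isVectorField_connection a c hX hY))))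

theorem isVectorField_lieBracket {X Y : Ambient n p → Ambient n p} (hX : IsVectorField X)
    (hY : IsVectorField Y) : IsVectorField (VectorField.lieBracket ℝ X Y) := by
  refine ⟨?_, fun x hx => ?_⟩
  · rw [VectorField.lieBracket_eq]
    exact (contDiff_fderiv_apply hX.1 hY.1).sub (contDiff_fderiv_apply hY.1 hX.1)
  · -- A torsion-free connection shows that the bracket is tangent; any parameters `a`, `c` do.
    rw [← connection_sub_connection 0 1]
    exact tangent_sub ((isVectorField_connection 0 1 hX hY).2 x hx)
      ((isVectorField_connection 0 1 hY hX).2 x hx)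

/-! ### The curvature tensor -/

/-- The curvature tensor at `x`, expressed by the Christoffel tensor. -/
def curvatureTensor (a c : ℝ) (x u v y : Ambient n p) : Ambient n p :=
  christoffelDeriv a c x u v y - christoffelDeriv a c x v u y +
    christoffel a c x u (christoffel a c x v y) - christoffel a c x v (christoffel a c x u y)

theorem fderiv_connection (a c : ℝ) {Y Z : Ambient n p → Ambient n p} (hY : IsVectorField Y)
    (hZ : IsVectorField Z) (x u : Ambient n p) :
    fderiv ℝ (connection a c Y Z) x u =
      fderiv ℝ (fderiv ℝ Z) x u (Y x) + fderiv ℝ Z x (fderiv ℝ Y x u) +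
        (christoffelDeriv a c x u (Y x) (Z x) + christoffel a c x (fderiv ℝ Y x u) (Z x) +
          christoffel a c x (Y x) (fderiv ℝ Z x u)) := by
  have hd : DifferentiableAt ℝ (connection a c Y Z) x :=
    ((contDiff_fderiv_apply hY.1 hZ.1).add
      (contDiff_christoffel a c contDiff_id hY.1 hZ.1)).contDiffAt.differentiableAt (by simp)
  have hZ' : DifferentiableAt ℝ (fderiv ℝ Z) x :=
    (hZ.1.fderiv_right (m := ∞) (by simp)).contDiffAt.differentiableAt (by simp)
  have hYl := hasDerivAt_comp_line (hY.differentiableAt x) u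
  have e := (hasDerivAt_comp_line hd u).unique
    (((hasDerivAt_comp_line hZ' u).clm_apply hYl).add (hasDerivAt_christoffel (hasDerivAt_line x u)
      hYl (hasDerivAt_comp_line (hZ.differentiableAt x) u)))
  simpa using e

/-- The curvature depends on the values of the fields at the point only: the second derivatives of
`Z` cancel by symmetry, and the first derivatives of `X`, `Y` cancel with the Lie bracket. -/
theorem IsLeviCivita.curvature_eq {a c : ℝ} (hc : 0 < c)
    {D : (Ambient n p → Ambient n p) → (Ambient n p → Ambient n p) → Ambient n p → Ambient n p}
    (hD : IsLeviCivita a c D) {X Y Z : Ambient n p → Ambient n p} (hX : IsVectorField X)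
    (hY : IsVectorField Y) (hZ : IsVectorField Z) {x : Ambient n p} (hx : x ∈ manifold n p) :
    curvature D X Y Z x = curvatureTensor a c x (X x) (Y x) (Z x) := by
  have second : ∀ {X Y}, IsVectorField X → IsVectorField Y → D X (D Y Z) x =
      fderiv ℝ (connection a c Y Z) x (X x) +
        christoffel a c x (X x) (connection a c Y Z x) := by
    intro X Y hX hY
    have hYZ := hD.isVectorField Y Z hY hZ
    rw [hD.eq_connection hc hX hYZ hx, connection, hD.eq_connection hc hY hZ hx,
      fderiv_apply_eq_of_eqOn (hD.eq_connection hc hY hZ) (hYZ.differentiableAt x)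
        ((isVectorField_connection a c hY hZ).differentiableAt x) hx (hX.2 x hx)]
  have hbr := isVectorField_lieBracket hX hY
  have hsymm : fderiv ℝ (fderiv ℝ Z) x (X x) (Y x) = fderiv ℝ (fderiv ℝ Z) x (Y x) (X x) :=
    ((contDiff_infty.mp hZ.1 2).contDiffAt.isSymmSndFDerivAt (by simp)).eq _ _
  rw [curvature, Pi.sub_apply, Pi.sub_apply, second hX hY, second hY hX,
    hD.eq_connection hc hbr hZ hx, fderiv_connection a c hY hZ, fderiv_connection a c hX hZ,
    connection, connection, connection, hsymm, VectorField.lieBracket, map_sub,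
    christoffel_sub_left, christoffel_add_right, christoffel_add_right, curvatureTensor]
  abel

/-- The mixed curvature: for `u`, `v` horizontal in the first factor and `y`, `w` horizontal in the
second one, only the derivative of the weight `weight₂`, which couples the factors, contributes. -/
theorem extMetric_curvatureTensor {a c : ℝ} {x u v y w : Ambient n p} (hu : u.2 = 0)
    (hv : v.2 = 0) (hy : y.1 = 0) (hw : w.1 = 0) (hxu : (inner ℂ x.1 u.1 : ℂ) = 0)
    (hxv : (inner ℂ x.1 v.1 : ℂ) = 0) (hxy : (inner ℂ x.2 y.2 : ℂ) = 0)
    (hxw : (inner ℂ x.2 w.2 : ℂ) = 0) :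
    extMetric a c x (curvatureTensor a c x u v y) w =
      -(2 * a / c) * (inner ℂ u.1 v.1 : ℂ).im * (inner ℂ y.2 w.2 : ℂ).im := by
  have f1 : fib₁ x w = 0 := by simp [fib₁, hw]
  have f2 : fib₂ x w = 0 := by simp [fib₂, hxw]
  have hvy : christoffel a c x v y = 0 := by
    simp [christoffel, christoffelFactor, weight₁, weight₂, fib₁, fib₂, hv, hy, hxv, hxy]
  have huy : christoffel a c x u y = 0 := by
    simp [christoffel, christoffelFactor, weight₁, weight₂, fib₁, fib₂, hu, hy, hxu, hxy]
  have h0 : ∀ u : Ambient n p, christoffel a c x u 0 = 0 := fun u => by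
    simp [christoffel, christoffelFactor, weight₁, weight₂, fib₁, fib₂]
  have hvu : (inner ℂ v.1 u.1 : ℂ).im = -(inner ℂ u.1 v.1 : ℂ).im := by
    rw [← inner_conj_symm, Complex.conj_im]
  have key : (curvatureTensor a c x u v y).2 =
      (((-(2 * a / c) * (inner ℂ u.1 v.1 : ℂ).im : ℝ) : ℂ) * Complex.I) • y.2 := by
    simp only [curvatureTensor, hvy, huy, h0, christoffelDeriv, christoffelFactorDeriv, weight₂,
      fib₁, fib₂, hu, hv, hxu, hxv, hxy, hy, Prod.snd_add, Prod.snd_sub, Prod.snd_zero,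
      inner_zero_left, inner_zero_right, Complex.zero_re, Complex.zero_im, hvu]
    push_cast
    module
  -- As `w` is horizontal in the second factor, only the second component of the curvature matters.
  rw [extMetric, f1, f2, hw, key, inner_smul_left]
  simp

/-! ### The basis of `𝔭` at the base point -/

/-- The scalar `1` for odd `k` and `i` for even `k`, the only nonzero entry of `Y_k · e_0`. -/
def frameScalar (k : ℕ) : ℂ := if Odd k then 1 else Complex.I

theorem toEuclideanLin_matY (n k : ℕ) (hk : 1 ≤ k) (i : Fin (n + 1)) :
    Matrix.toEuclideanLin (matY n k) (EuclideanSpace.single 0 1) i =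
      if (i : ℕ) = (k + 1) / 2 then frameScalar k else 0 := by
  have h : Matrix.toEuclideanLin (matY n k) (EuclideanSpace.single 0 1) i = matY n k i 0 := by
    simp [Matrix.toLpLin_apply]
  rw [h]
  by_cases ho : Odd k
  · have : (k + 1) / 2 ≠ 0 := by omega
    simp [matY, ho, matZ, matE, frameScalar, this.symm]
  · have he : (k + 1) / 2 = k / 2 := by
      have := Nat.not_odd_iff_even.mp ho
      grind
    have : k / 2 ≠ 0 := by grind
    simp [matY, ho, matT, matE, frameScalar, this.symm, he]

theorem inner_base_matY (n k : ℕ) (hk : 1 ≤ k) :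
    (inner ℂ (EuclideanSpace.single 0 1 : EuclideanSpace ℂ (Fin (n + 1)))
      (Matrix.toEuclideanLin (matY n k) (EuclideanSpace.single 0 1)) : ℂ) = 0 := by
  rw [EuclideanSpace.inner_single_left, toEuclideanLin_matY n k hk, if_neg, mul_zero]
  simp only [Fin.val_zero]
  omega

/-- `⟨Y_j, Y_k⟩` vanishes unless both belong to the same complex coordinate, and then it is
`⟨e, i e⟩ = i`. -/
theorem im_inner_matY {n j k : ℕ} (hj : 1 ≤ j) (hjk : j < k) (hk : k ≤ 2 * n) :
    (inner ℂ (Matrix.toEuclideanLin (matY n j) (EuclideanSpace.single 0 1))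
      (Matrix.toEuclideanLin (matY n k) (EuclideanSpace.single 0 1)) : ℂ).im =
      if Odd j ∧ k = j + 1 then 1 else 0 := by
  have hlt : (k + 1) / 2 < n + 1 := by omega
  rw [PiLp.inner_apply, Finset.sum_eq_single ⟨(k + 1) / 2, hlt⟩]
  · rw [toEuclideanLin_matY n j hj, toEuclideanLin_matY n k (by omega)]
    by_cases h : Odd j ∧ k = j + 1
    · have hk' : ¬ Odd k := by grind
      have e : (k + 1) / 2 = (j + 1) / 2 := by grind
      simp only [e, frameScalar, if_pos h.1, if_neg hk', if_pos h, if_true]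
      simp
    · have e : (k + 1) / 2 ≠ (j + 1) / 2 := by grind
      simp [h, e]
  · intro i _ hi
    rw [toEuclideanLin_matY n k (by omega), if_neg, inner_zero_right]
    exact fun h => hi (Fin.ext h)
  · simp

theorem action_basisElt_left {n p : ℕ} (a c : ℝ) {k : ℕ} (h1 : 1 ≤ k) (h2 : k ≤ 2 * n) :
    action (basisElt n p a c k) (basePoint n p) =
      (Matrix.toEuclideanLin (matY n k) (EuclideanSpace.single 0 1), 0) := by
  rw [basisElt, if_neg (by omega), if_pos h2]
  simp [action, basePoint]

theorem action_basisElt_right {n p : ℕ} (a c : ℝ) {k : ℕ} (h : 2 * n + 2 ≤ k) :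
    action (basisElt n p a c k) (basePoint n p) =
      (0, Matrix.toEuclideanLin (matY p (k - (2 * n + 1))) (EuclideanSpace.single 0 1)) := by
  rw [basisElt, if_neg (by omega), if_neg (by omega), if_neg (by omega)]
  simp [action, basePoint]

theorem basePoint_mem (n p : ℕ) : basePoint n p ∈ manifold n p := by
  simp [manifold, basePoint]

/-- All mixed components at once; the first slot pairs the two real directions of one complex
coordinate exactly when `α` is odd and `ν = α + 1`, and likewise for `ρ - (2n+1)` and `μ`. -/
theorem component_mixed {a c : ℝ} (hc : 0 < c)
    {D : (Ambient n p → Ambient n p) → (Ambient n p → Ambient n p) → Ambient n p → Ambient n p}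
    (hD : IsLeviCivita a c D) {Z : ℕ → Ambient n p → Ambient n p} (hZ : IsFrame a c Z)
    {α ν ρ μ : ℕ} (hα : 1 ≤ α) (hαν : α < ν) (hν : ν ≤ 2 * n) (hρ : 2 * n + 2 ≤ ρ) (hρμ : ρ < μ)
    (hμ : μ ≤ 2 * n + 2 * p + 1) :
    component a c D Z α ν ρ μ =
      if (Odd α ∧ ν = α + 1) ∧ (Even ρ ∧ μ = ρ + 1) then 2 * a / c else 0 := by
  obtain ⟨vα, eα⟩ := hZ α (by omega)
  obtain ⟨vν, eν⟩ := hZ ν (by omega)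
  obtain ⟨vρ, eρ⟩ := hZ ρ (by omega)
  obtain ⟨vμ, eμ⟩ := hZ μ (by omega)
  rw [action_basisElt_left a c hα (by omega)] at eα
  rw [action_basisElt_left a c (by omega) hν] at eν
  rw [action_basisElt_right a c hρ] at eρ
  rw [action_basisElt_right a c (by omega)] at eμ
  have ho := basePoint_mem n p
  have hcurv : IsVectorField (curvature D (Z α) (Z ν) (Z μ)) :=
    ((hD.isVectorField _ _ vα (hD.isVectorField _ _ vν vμ)).sub
      (hD.isVectorField _ _ vν (hD.isVectorField _ _ vα vμ))).sub
      (hD.isVectorField _ _ (isVectorField_lieBracket vα vν) vμ)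
  have key := extMetric_curvatureTensor (a := a) (c := c) (x := basePoint n p)
    (congrArg Prod.snd eα) (congrArg Prod.snd eν) (congrArg Prod.fst eμ) (congrArg Prod.fst eρ)
    (by rw [eα]; exact inner_base_matY n α hα) (by rw [eν]; exact inner_base_matY n ν (by omega))
    (by rw [eμ]; exact inner_base_matY p _ (by omega))
    (by rw [eρ]; exact inner_base_matY p _ (by omega))
  rw [component, metric_eq_extMetric ho (hcurv.2 _ ho) (vρ.2 _ ho), hD.curvature_eq hc vα vν vμ ho,
    key, eα, eν, eρ, eμ, im_inner_matY hα hαν hν, ← inner_conj_symm, Complex.conj_im,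
    im_inner_matY (by omega) (by omega) (by omega)]
  have e : (Odd (ρ - (2 * n + 1)) ∧ μ - (2 * n + 1) = ρ - (2 * n + 1) + 1) ↔
      (Even ρ ∧ μ = ρ + 1) := by grind
  simp only [e]
  split_ifs <;> simp_all

end SphereProduct

end

theorem proposition4 (n p : ℕ) (a c : ℝ) (hc : 0 < c)
    (D : (SphereProduct.Ambient n p → SphereProduct.Ambient n p) →
      (SphereProduct.Ambient n p → SphereProduct.Ambient n p) →
      SphereProduct.Ambient n p → SphereProduct.Ambient n p)
    (hD : SphereProduct.IsLeviCivita a c D)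
    (Z : ℕ → SphereProduct.Ambient n p → SphereProduct.Ambient n p)
    (hZ : SphereProduct.IsFrame a c Z) :
    (∀ l m : ℕ, 1 ≤ l → l ≤ n → 1 ≤ m → m ≤ p →
      SphereProduct.component a c D Z (2 * l - 1) (2 * l) (2 * n + 2 * m) (2 * n + 2 * m + 1) =
        2 * a / c) ∧
    (∀ α ν ρ μ : ℕ, 1 ≤ α → α < ν → ν ≤ 2 * n →
      2 * n + 2 ≤ ρ → ρ < μ → μ ≤ 2 * n + 2 * p + 1 →
      (¬ ∃ l m : ℕ, 1 ≤ l ∧ l ≤ n ∧ 1 ≤ m ∧ m ≤ p ∧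
        α = 2 * l - 1 ∧ ν = 2 * l ∧ ρ = 2 * n + 2 * m ∧ μ = 2 * n + 2 * m + 1) →
      SphereProduct.component a c D Z α ν ρ μ = 0) := by
  refine ⟨fun l m hl hln hm hmp => ?_, fun α ν ρ μ hα hαν hν hρ hρμ hμ hne => ?_⟩
  · rw [SphereProduct.component_mixed hc hD hZ (by omega) (by omega) (by omega) (by omega)
      (by omega) (by omega), if_pos]
    exact ⟨⟨⟨l - 1, by omega⟩, by omega⟩, ⟨n + m, by omega⟩, by omega⟩
  · rw [SphereProduct.component_mixed hc hD hZ hα hαν hν hρ hρμ hμ, if_neg]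
    rintro ⟨⟨⟨l, rfl⟩, rfl⟩, ⟨m, rfl⟩, rfl⟩
    exact hne ⟨l + 1, m - n, by omega⟩
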